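/- **Theorem (Characterization of congruences).** Let $\mathbf A,\mathbf B$ be bounded distributive lattices and let $\mathcal M=\langle \mathbf A,\mathbf B,f,i\rangle$ be a FIDL-module: $f:A\times B\to A$ and $i:B\times A\to A$ satisfy, for all $x,y\in A$ and $b,c\in B$, $f(x\vee y,b)=f(x,b)\vee f(y,b)$, $f(x,b\vee c)=f(x,b)\vee f(x,c)$, $f(0,b)=0=f(x,0)$, $i(b,x\wedge y)=i(b,x)\wedge i(b,y)$, $i(b\vee c,x)=i(b,x)\wedge i(c,x)$, $i(b,1)=1$. For a bounded distributive lattice $\mathbf L$ let $\mathcal X(\mathbf L)$ be the set of its prime (proper) filters, ordered by inclusion, with the topology having as subbase the sets $\beta(a)=\{P: a\in P\}$ and their complements ($a\in L$). For a closed set $Y\subseteq\mathcal X(\mathbf L)$ let $\theta(Y)=\{(a,b)\in L^2:\beta(a)\cap Y=\beta(b)\cap Y\}$, a congruence of $\mathbf L$. The Urquhart space $\mathcal F_{\mathcal M}$ of $\mathcal M$ consists of $X=\mathcal X(\mathbf A)$ and $Y=\mathcal X(\mathbf B)$ with the relations $R\subseteq X\times Y\times X$ and $T\subseteq Y\times X\times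 X$, where $(Q,S,P)\in R$ iff every $x\in A$ with $f(q,s)\le x$ for some $q\in Q$, $s\in S$ lies in $P$, and $(S,P,Q)\in T$ iff every $x\in A$ with $p\le i(s,x)$ for some $s\in S$, $p\in P$ lies in $Q$. For $P\in X$ let $\mathrm{Max}(R^{-1}(P))$ be the set of pairs $(Q,S)\in X\times Y$ such that $Q$ is a maximal element of $\{Q'\in X:(Q',S,P)\in R\}$ and $S$ is a maximal element of $\{S'\in Y:(Q,S',P)\in R\}$; let $\mathcal D(P)$ be the set of pairs $(S,Q)\in Y\times X$ such that $S$ is a maximal element of $\{S'\in Y:(S',P,Q)\in T\}$ and $Q$ is a minimal element of $\{Q'\in X:(S,P,Q')\in T\}$. A pair $(Z_1,Z_2)$ of closed sets $Z_1\subseteq X$, $Z_2\subseteq Y$ is *$R$-closed* if $\mathrm{Max}(R^{-1}(P))\subseteq Z_1\times Z_2$ for all $P\in Z_1$, *$T$-closed* if $\mathcal D(P)\subseteq Z_2\times Z_1$ for all $P\in Z_1$, and *strongly closed* if it is both. A pair $(\theta_A,\theta_B)$ of a congruence of $\mathbf A$ and a congruence of $\mathbf B$ is an *FDL-congruence* if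 $(f(a,b),f(c,d))\in\theta_A$ whenever $(a,c)\in\theta_A$ and $(b,d)\in\theta_B$, an *IDL-congruence* if $(i(b,a),i(d,c))\in\theta_A$ whenever $(a,c)\in\theta_A$ and $(b,d)\in\theta_B$, and an *FIDL-congruence* if it is both. All sets of pairs are ordered by componentwise inclusion. Then the map $(Z_1,Z_2)\mapsto(\theta(Z_1),\theta(Z_2))$ restricts to the following order anti-isomorphisms: 1. from the $R$-closed pairs onto the FDL-congruences of $\mathcal M$; 2. from the $T$-closed pairs onto the IDL-congruences of $\mathcal M$, provided $i(0,x)=1$ for all $x\in A$; 3. from the strongly closed pairs onto the FIDL-congruences of $\mathcal M$, provided $i(0,x)=1$ for all $x\in A$. -/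

import Mathlib

open TopologicalSpace

universe u v

/-! ### Modules with fusion and implication over bounded distributive lattices -/

/-- A fusion `f : A × B → A` preserving finite joins (including the empty one) in each variable. -/
structure FDLModule (A : Type u) (B : Type v) [DistribLattice A] [BoundedOrder A]
    [DistribLattice B] [BoundedOrder B] where
  f : A → B → A
  f_sup_left : ∀ (x y : A) (b : B), f (x ⊔ y) b = f x b ⊔ f y b
  f_sup_right : ∀ (x : A) (b c : B), f x (b ⊔ c) = f x b ⊔ f x c
  f_bot_left : ∀ b : B, f ⊥ b = ⊥
  f_bot_right : ∀ x : A, f x ⊥ = ⊥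

/-- An implication `i : B × A → A`. -/
structure IDLModule (A : Type u) (B : Type v) [DistribLattice A] [BoundedOrder A]
    [DistribLattice B] [BoundedOrder B] where
  i : B → A → A
  i_inf : ∀ (b : B) (x y : A), i b (x ⊓ y) = i b x ⊓ i b y
  i_sup : ∀ (b c : B) (x : A), i (b ⊔ c) x = i b x ⊓ i c x
  i_top : ∀ b : B, i b ⊤ = ⊤

/-- A FIDL-module `⟨A, B, f, i⟩`. -/
structure FIDLModule (A : Type u) (B : Type v) [DistribLattice A] [BoundedOrder A]
    [DistribLattice B] [BoundedOrder B] extends FDLModule A B, IDLModule A B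

/-! ### The Priestley space of prime filters -/

/-- The set of prime (in particular proper) filters of `A`. -/
def PrimeFilter (A : Type u) [DistribLattice A] [BoundedOrder A] : Type u :=
  {P : Order.PFilter A // P.IsPrime}

namespace PrimeFilter

variable {A : Type u} [DistribLattice A] [BoundedOrder A]

/-- Prime filters are ordered by inclusion. -/
instance : PartialOrder (PrimeFilter A) :=
  inferInstanceAs (PartialOrder {P : Order.PFilter A // P.IsPrime})

/-- The underlying set of a prime filter. -/
def carrier (P : PrimeFilter A) : Set A := (P.1 : Set A)

/-- `β(a)`, the set of prime filters that contain `a`. -/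
def beta (a : A) : Set (PrimeFilter A) := {P | a ∈ P.carrier}

/-- The Priestley topology, with subbase the sets `β(a)` and their complements. -/
instance : TopologicalSpace (PrimeFilter A) :=
  generateFrom (Set.range (beta (A := A)) ∪ Set.range (fun a : A => (beta a)ᶜ))

theorem beta_inf (a b : A) : beta (a ⊓ b) = beta a ∩ beta b := by
  ext P
  exact Order.PFilter.inf_mem_iff

theorem beta_sup (a b : A) : beta (a ⊔ b) = beta a ∪ beta b := by
  ext P
  constructor
  · intro h
    by_contra hn
    have ha : a ∈ (P.1 : Set A)ᶜ := fun h' => hn (Or.inl h')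
    have hb : b ∈ (P.1 : Set A)ᶜ := fun h' => hn (Or.inr h')
    have hI := P.2.compl_ideal.toIdeal.sup_mem (x := a) (y := b) ha hb
    exact hI h
  · rintro (h | h)
    · exact P.1.mem_of_le le_sup_left h
    · exact P.1.mem_of_le le_sup_right h

end PrimeFilter

/-- The congruence `θ(Y) = {(a, b) | β(a) ∩ Y = β(b) ∩ Y}` attached to a set of prime filters. -/
def theta {A : Type u} [DistribLattice A] [BoundedOrder A] (Y : Set (PrimeFilter A)) :
    LatticeCon A where
  r a b := PrimeFilter.beta a ∩ Y = PrimeFilter.beta b ∩ Y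
  iseqv := ⟨fun _ => rfl, fun h => h.symm, fun h h' => h.trans h'⟩
  inf := by
    intro w x y z h h'
    rw [PrimeFilter.beta_inf, PrimeFilter.beta_inf, Set.inter_inter_distrib_right, h, h',
      ← Set.inter_inter_distrib_right]
  sup := by
    intro w x y z h h'
    rw [PrimeFilter.beta_sup, PrimeFilter.beta_sup, Set.union_inter_distrib_right, h, h',
      ← Set.union_inter_distrib_right]

/-- Congruences of a lattice are ordered by inclusion. -/
instance {L : Type u} [Lattice L] : PartialOrder (LatticeCon L) :=
  PartialOrder.lift LatticeCon.toSetoid (by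
    rintro ⟨s, _, _⟩ ⟨t, _, _⟩ h
    cases h
    rfl)

/-! ### Relational bi-spaces and their closed pairs -/

/-- A pair of relations `R ⊆ X × Y × X` and `T ⊆ Y × X × X`, the relational part of a structure
`⟨X, Y, ≤, ≤, τ, τ, R, T⟩`. -/
structure BiRel (X : Type u) (Y : Type v) where
  R : X → Y → X → Prop
  T : Y → X → X → Prop

namespace BiRel

variable {X : Type u} {Y : Type v} [PartialOrder X] [PartialOrder Y]

/-- `R¹(y, z)`: the maximal elements of `{x | (x, y, z) ∈ R}`. -/
def R1 (U : BiRel X Y) (y : Y) (z : X) : Set X := {x | Maximal (fun x' => U.R x' y z) x}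

/-- `R²(x, z)`: the maximal elements of `{y | (x, y, z) ∈ R}`. -/
def R2 (U : BiRel X Y) (x z : X) : Set Y := {y | Maximal (fun y' => U.R x y' z) y}

/-- `T¹(x, z)`: the maximal elements of `{y | (y, x, z) ∈ T}`. -/
def T1 (U : BiRel X Y) (x z : X) : Set Y := {y | Maximal (fun y' => U.T y' x z) y}

/-- `T³(y, x)`: the minimal elements of `{z | (y, x, z) ∈ T}`. -/
def T3 (U : BiRel X Y) (y : Y) (x : X) : Set X := {z | Minimal (fun z' => U.T y x z') z}

/-- `Max(R⁻¹(z))`. -/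
def maxR (U : BiRel X Y) (z : X) : Set (X × Y) := {p | p.1 ∈ U.R1 p.2 z ∧ p.2 ∈ U.R2 p.1 z}

/-- `𝒟(x)`. -/
def D (U : BiRel X Y) (x : X) : Set (Y × X) := {p | p.1 ∈ U.T1 x p.2 ∧ p.2 ∈ U.T3 p.1 x}

variable [TopologicalSpace X] [TopologicalSpace Y]

/-- A pair of closed sets is `R`-closed. -/
def IsRClosed (U : BiRel X Y) (Z : Closeds X × Closeds Y) : Prop :=
  ∀ z ∈ Z.1, U.maxR z ⊆ (Z.1 : Set X) ×ˢ (Z.2 : Set Y)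

/-- A pair of closed sets is `T`-closed. -/
def IsTClosed (U : BiRel X Y) (Z : Closeds X × Closeds Y) : Prop :=
  ∀ x ∈ Z.1, U.D x ⊆ (Z.2 : Set Y) ×ˢ (Z.1 : Set X)

/-- A pair of closed sets is strongly closed. -/
def IsStronglyClosed (U : BiRel X Y) (Z : Closeds X × Closeds Y) : Prop :=
  U.IsRClosed Z ∧ U.IsTClosed Z

end BiRel

/-! ### The dual space and the congruences of a FIDL-module -/

namespace FIDLModule

variable {A : Type u} {B : Type v} [DistribLattice A] [BoundedOrder A]
  [DistribLattice B] [BoundedOrder B]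

/-- `f(G, H) = {x | ∃ g ∈ G, ∃ h ∈ H, f(g, h) ≤ x}`. -/
def fSet (M : FIDLModule A B) (G : Set A) (H : Set B) : Set A :=
  {x | ∃ g ∈ G, ∃ h ∈ H, M.f g h ≤ x}

/-- `i(H, G) = {x | ∃ h ∈ H, ∃ g ∈ G, g ≤ i(h, x)}`. -/
def iSet (M : FIDLModule A B) (H : Set B) (G : Set A) : Set A :=
  {x | ∃ h ∈ H, ∃ g ∈ G, g ≤ M.i h x}

/-- The relations `R_M` and `T_M` on the Priestley spaces of `A` and `B`; together with the order
and the topology of these spaces they make up the dual space of `M`. -/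
def dualSpace (M : FIDLModule A B) : BiRel (PrimeFilter A) (PrimeFilter B) where
  R Q S P := M.fSet Q.carrier S.carrier ⊆ P.carrier
  T S P Q := M.iSet S.carrier P.carrier ⊆ Q.carrier

/-- FDL-congruences. -/
def IsFDLCon (M : FIDLModule A B) (t : LatticeCon A × LatticeCon B) : Prop :=
  ∀ ⦃a c : A⦄ ⦃b d : B⦄, t.1.r a c → t.2.r b d → t.1.r (M.f a b) (M.f c d)

/-- IDL-congruences. -/
def IsIDLCon (M : FIDLModule A B) (t : LatticeCon A × LatticeCon B) : Prop :=
  ∀ ⦃a c : A⦄ ⦃b d : B⦄, t.1.r a c → t.2.r b d → t.1.r (M.i b a) (M.i d c)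

/-- FIDL-congruences. -/
def IsFIDLCon (M : FIDLModule A B) (t : LatticeCon A × LatticeCon B) : Prop :=
  M.IsFDLCon t ∧ M.IsIDLCon t

end FIDLModule

/-! By Priestley duality `theta` is an order-reversing bijection between closed sets of prime
filters and lattice congruences: distinct closed sets are separated by a basic open set
(`theta_le_theta_iff`), and a congruence is recovered from its saturated primes
(`LatticeCon.theta_saturatedPrimes`). What remains is that closedness of a pair matches
compatibility with f or i.

The relation R(Q, S, P) says that Q, or equivalently S, avoids an ideal defined by f, P and the
other filter. If f(a, b) ∈ P, some pair in Max(R⁻¹(P)) contains a and b (`exists_mem_maxR`). For an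
R-closed pair of sets and P in the first of them, both filters lie in the closed sets, so a and b
may be replaced by congruent elements. Conversely, a filter maximal among those avoiding an ideal
meets each outside element inside that ideal (`exists_inf_mem_of_maximal`). Compatibility with f
then makes the filter saturated, hence a member of the closed set (`mem_of_theta_saturated`). For T
the same argument runs with an ideal of B and, dually, minimal prime filters above a filter of A. -/

namespace PrimeFilter

/-! ### Prime filters and separation -/

theorem disjoint_Ici {A : Type u} [Preorder A] {I : Set A} (hI : Order.IsIdeal I)
    {a : A} (h : a ∉ I) : Disjoint (Set.Ici a) I :=
  Set.disjoint_left.2 fun _ hx hxI => h (hI.IsLowerSet hx hxI)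

section

variable {A : Type u} [DistribLattice A] [BoundedOrder A]

theorem le_iff {P Q : PrimeFilter A} : P ≤ Q ↔ P.carrier ⊆ Q.carrier := Iff.rfl

theorem mem_of_le (P : PrimeFilter A) {a b : A} (h : a ≤ b) (ha : a ∈ P.carrier) :
    b ∈ P.carrier := P.1.mem_of_le h ha

theorem top_mem (P : PrimeFilter A) : ⊤ ∈ P.carrier := Order.PFilter.top_mem

theorem inf_mem_iff (P : PrimeFilter A) {a b : A} :
    a ⊓ b ∈ P.carrier ↔ a ∈ P.carrier ∧ b ∈ P.carrier := Order.PFilter.inf_mem_iff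

theorem sup_mem_iff (P : PrimeFilter A) {a b : A} :
    a ⊔ b ∈ P.carrier ↔ a ∈ P.carrier ∨ b ∈ P.carrier :=
  Set.ext_iff.1 (beta_sup a b) P

theorem bot_notMem (P : PrimeFilter A) : ⊥ ∉ P.carrier := by
  obtain ⟨x, hx⟩ := P.2.compl_ideal.Nonempty
  exact fun h => hx (P.mem_of_le bot_le h)

theorem isIdeal_of {I : Set A} (bot : ⊥ ∈ I) (lower : ∀ {a b}, a ≤ b → b ∈ I → a ∈ I)
    (sup : ∀ {a b}, a ∈ I → b ∈ I → a ⊔ b ∈ I) : Order.IsIdeal I :=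
  ⟨fun _ _ h hb => lower h hb, ⟨⊥, bot⟩,
    fun _ ha _ hb => ⟨_, sup ha hb, le_sup_left, le_sup_right⟩⟩

theorem isPFilter_of {F : Set A} (top : ⊤ ∈ F) (upper : ∀ {a b}, a ≤ b → a ∈ F → b ∈ F)
    (inf : ∀ {a b}, a ∈ F → b ∈ F → a ⊓ b ∈ F) : Order.IsPFilter F :=
  .of_def ⟨⊤, top⟩ (fun _ ha _ hb => ⟨_, inf ha hb, inf_le_left, inf_le_right⟩) upper

/-- A prime filter from a set with the closure properties of one. -/
theorem exists_carrier_eq {F : Set A} (top : ⊤ ∈ F) (bot : ⊥ ∉ F)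
    (upper : ∀ {a b}, a ≤ b → a ∈ F → b ∈ F) (inf : ∀ {a b}, a ∈ F → b ∈ F → a ⊓ b ∈ F)
    (prime : ∀ {a b}, a ⊔ b ∈ F → a ∈ F ∨ b ∈ F) : ∃ P : PrimeFilter A, P.carrier = F :=
  ⟨⟨(isPFilter_of top upper inf).toPFilter,
    ⟨isIdeal_of (I := Fᶜ) bot (fun h hb ha => hb (upper h ha))
      (fun ha hb h => (prime h).elim ha hb)⟩⟩, rfl⟩

theorem isPFilter_carrier (P : PrimeFilter A) : Order.IsPFilter P.carrier := P.1.isPFilter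

/-- The prime filter theorem. -/
theorem exists_of_disjoint {F I : Set A} (hF : Order.IsPFilter F) (hI : Order.IsIdeal I)
    (h : Disjoint F I) : ∃ P : PrimeFilter A, F ⊆ P.carrier ∧ Disjoint P.carrier I := by
  obtain ⟨J, hJ, hIJ, hFJ⟩ :=
    DistribLattice.prime_ideal_of_disjoint_filter_ideal (F := hF.toPFilter) (I := hI.toIdeal) h
  refine ⟨⟨hJ.toPrimePair.F, hJ.toPrimePair.F_isPrime⟩, fun x hx hxJ => ?_, ?_⟩
  · exact Set.disjoint_left.1 hFJ hx hxJ
  · exact Set.disjoint_left.2 fun x hx hxI => hx (hIJ hxI)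

theorem isPFilter_Ici (a : A) : Order.IsPFilter (Set.Ici a) :=
  isPFilter_of le_top (fun h h' => le_trans h' h) le_inf

theorem isIdeal_Iic (a : A) : Order.IsIdeal (Set.Iic a) :=
  isIdeal_of bot_le (fun h h' => le_trans h h') sup_le

/-! ### Maximal and minimal prime filters -/

theorem exists_maximal_disjoint {I : Set A} (P : PrimeFilter A) (h : Disjoint P.carrier I) :
    ∃ Q, P ≤ Q ∧ Maximal (fun Q : PrimeFilter A => Disjoint Q.carrier I) Q := by
  refine zorn_le_nonempty₀ {Q : PrimeFilter A | Disjoint Q.carrier I} (fun c hc hchain Q₀ hQ₀ => ?_)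
    P h
  obtain ⟨U, hU⟩ : ∃ U : PrimeFilter A, U.carrier = {x | ∃ Q ∈ c, x ∈ Q.carrier} := by
    refine exists_carrier_eq ⟨Q₀, hQ₀, Q₀.top_mem⟩ ?_ ?_ ?_ ?_
    · rintro ⟨Q, -, hQ⟩
      exact Q.bot_notMem hQ
    · rintro a b hab ⟨Q, hQ, ha⟩
      exact ⟨Q, hQ, Q.mem_of_le hab ha⟩
    · rintro a b ⟨Q, hQ, ha⟩ ⟨Q', hQ', hb⟩
      rcases hchain.total hQ hQ' with hle | hle
      · exact ⟨Q', hQ', Q'.inf_mem_iff.2 ⟨hle ha, hb⟩⟩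
      · exact ⟨Q, hQ, Q.inf_mem_iff.2 ⟨ha, hle hb⟩⟩
    · rintro a b ⟨Q, hQ, hab⟩
      exact (Q.sup_mem_iff.1 hab).imp (fun h => ⟨Q, hQ, h⟩) fun h => ⟨Q, hQ, h⟩
  refine ⟨U, Set.disjoint_left.2 ?_, fun Q hQ => le_iff.2 fun x hx => ?_⟩
  · rw [hU]
    rintro x ⟨Q, hQ, hx⟩
    exact Set.disjoint_left.1 (hc hQ) hx
  · rw [hU]
    exact ⟨Q, hQ, hx⟩

theorem exists_minimal_superset {F : Set A} (P : PrimeFilter A) (h : F ⊆ P.carrier) :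
    ∃ Q, Q ≤ P ∧ Minimal (fun Q : PrimeFilter A => F ⊆ Q.carrier) Q := by
  refine zorn_le_nonempty₀ (α := (PrimeFilter A)ᵒᵈ)
    {Q : PrimeFilter A | F ⊆ Q.carrier} (fun c hc hchain Q₀ hQ₀ => ?_) P h
  obtain ⟨U, hU⟩ : ∃ U : PrimeFilter A,
      U.carrier = {x | ∀ Q : PrimeFilter A, Q ∈ c → x ∈ Q.carrier} := by
    refine exists_carrier_eq (fun Q _ => Q.top_mem) (fun h => bot_notMem _ (h Q₀ hQ₀))
      (fun hab ha Q hQ => Q.mem_of_le hab (ha Q hQ))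
      (fun ha hb Q hQ => Q.inf_mem_iff.2 ⟨ha Q hQ, hb Q hQ⟩) fun {a b} hab => ?_
    by_contra! hn
    obtain ⟨hna, hnb⟩ := hn
    simp only [Set.mem_ofPred_eq, not_forall] at hna hnb
    obtain ⟨Q, hQ, ha⟩ := hna
    obtain ⟨Q', hQ', hb⟩ := hnb
    -- The smaller of the two filters omits both a and b, against primeness; `hle` is read in the
    -- dual order.
    rcases hchain.total hQ hQ' with hle | hle
    · exact (Q'.sup_mem_iff.1 (hab Q' hQ')).elim (fun h => ha (le_iff.1 hle h)) hb
    · exact (Q.sup_mem_iff.1 (hab Q hQ)).elim ha (fun h => hb (le_iff.1 hle h))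
  refine ⟨U, fun x hx => ?_, fun Q hQ => le_iff.2 fun x hx => ?_⟩
  · rw [hU]
    exact fun Q hQ => hc hQ hx
  · rw [hU] at hx
    exact hx Q hQ

/-- Otherwise the filter generated by P and y misses I, and a prime filter containing it and
avoiding I contradicts maximality. -/
theorem exists_inf_mem_of_maximal {I : Set A} (hI : Order.IsIdeal I) {P : PrimeFilter A}
    (h : Maximal (fun Q : PrimeFilter A => Disjoint Q.carrier I) P) {y : A} (hy : y ∉ P.carrier) :
    ∃ p ∈ P.carrier, p ⊓ y ∈ I := by
  by_contra! hn
  have hF : Order.IsPFilter {x | ∃ p ∈ P.carrier, p ⊓ y ≤ x} := by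
    refine isPFilter_of ⟨⊤, P.top_mem, le_top⟩ ?_ ?_
    · rintro a b hab ⟨p, hp, hpa⟩
      exact ⟨p, hp, hpa.trans hab⟩
    · rintro a b ⟨p, hp, hpa⟩ ⟨q, hq, hqb⟩
      exact ⟨p ⊓ q, P.inf_mem_iff.2 ⟨hp, hq⟩,
        le_inf ((inf_le_inf_right _ inf_le_left).trans hpa)
          ((inf_le_inf_right _ inf_le_right).trans hqb)⟩
  obtain ⟨Q, hFQ, hQI⟩ := exists_of_disjoint hF hI <| Set.disjoint_left.2 <| by
    rintro x ⟨p, hp, hpx⟩ hx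
    exact hn p hp (hI.IsLowerSet hpx hx)
  have hPQ : P ≤ Q := fun p hp => hFQ ⟨p, hp, inf_le_left⟩
  exact hy (h.2 hQI hPQ (hFQ ⟨⊤, P.top_mem, inf_le_right⟩))

theorem exists_sup_mem_of_minimal {F : Set A} (hF : Order.IsPFilter F) {P : PrimeFilter A}
    (h : Minimal (fun Q : PrimeFilter A => F ⊆ Q.carrier) P) {y : A} (hy : y ∈ P.carrier) :
    ∃ p ∉ P.carrier, p ⊔ y ∈ F := by
  by_contra! hn
  have hI : Order.IsIdeal {x | ∃ p ∉ P.carrier, x ≤ p ⊔ y} := by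
    refine isIdeal_of ⟨⊥, P.bot_notMem, bot_le⟩ ?_ ?_
    · rintro a b hab ⟨p, hp, hpa⟩
      exact ⟨p, hp, hab.trans hpa⟩
    · rintro a b ⟨p, hp, hpa⟩ ⟨q, hq, hqb⟩
      exact ⟨p ⊔ q, fun h => (P.sup_mem_iff.1 h).elim hp hq,
        sup_le (hpa.trans (sup_le_sup_right le_sup_left _))
          (hqb.trans (sup_le_sup_right le_sup_right _))⟩
  obtain ⟨Q, hFQ, hQI⟩ := exists_of_disjoint hF hI <| Set.disjoint_left.2 <| by
    rintro x hx ⟨p, hp, hpx⟩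
    exact hn p hp (hF.toPFilter.mem_of_le hpx hx)
  have hQP : Q ≤ P := le_iff.2 fun p hp => by
    by_contra hpP
    exact Set.disjoint_left.1 hQI hp ⟨p, hpP, le_sup_left⟩
  exact Set.disjoint_left.1 hQI (h.2 hFQ hQP hy) ⟨⊥, P.bot_notMem, le_sup_right⟩

/-! ### A base of the Priestley topology -/

theorem isOpen_beta (a : A) : IsOpen (beta a) :=
  isOpen_generateFrom_of_mem (Or.inl ⟨a, rfl⟩)

theorem isClosed_beta (a : A) : IsClosed (beta a) :=
  ⟨isOpen_generateFrom_of_mem (Or.inr ⟨a, rfl⟩)⟩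

/-- Since β preserves meets and joins, the differences β(a) \ β(b) are closed under finite
intersection, so they form a base. -/
theorem exists_beta_diff_subset {U : Set (PrimeFilter A)} (hU : IsOpen U) {P : PrimeFilter A}
    (hP : P ∈ U) : ∃ a b, P ∈ beta a \ beta b ∧ beta a \ beta b ⊆ U := by
  induction hU with
  | basic s hs =>
    rcases hs with ⟨a, rfl⟩ | ⟨a, rfl⟩
    · exact ⟨a, ⊥, ⟨hP, P.bot_notMem⟩, Set.sdiff_subset⟩
    · exact ⟨⊤, a, ⟨P.top_mem, hP⟩, fun Q hQ => hQ.2⟩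
  | univ => exact ⟨⊤, ⊥, ⟨P.top_mem, P.bot_notMem⟩, Set.subset_univ _⟩
  | inter s t _ _ ihs iht =>
    obtain ⟨a, b, hab, hs⟩ := ihs hP.1
    obtain ⟨c, d, hcd, ht⟩ := iht hP.2
    refine ⟨a ⊓ c, b ⊔ d, ?_, ?_⟩
    · rw [beta_inf, beta_sup]
      exact ⟨⟨hab.1, hcd.1⟩, fun h => h.elim hab.2 hcd.2⟩
    · rw [beta_inf, beta_sup]
      exact fun Q hQ => ⟨hs ⟨hQ.1.1, fun h => hQ.2 (Or.inl h)⟩,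
        ht ⟨hQ.1.2, fun h => hQ.2 (Or.inr h)⟩⟩
  | sUnion S _ ih =>
    obtain ⟨s, hs, hPs⟩ := hP
    obtain ⟨a, b, hab, h⟩ := ih s hs hPs
    exact ⟨a, b, hab, h.trans (Set.subset_sUnion_of_mem hs)⟩

end

end PrimeFilter

/-! ### Congruences of a bounded distributive lattice and closed sets of prime filters -/

section Congruence

variable {A : Type u} [DistribLattice A] [BoundedOrder A]

theorem LatticeCon.le_iff {L : Type u} [Lattice L] {s t : LatticeCon L} :
    s ≤ t ↔ ∀ ⦃a b⦄, s.r a b → t.r a b := Iff.rfl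

theorem theta_r_iff {Y : Set (PrimeFilter A)} {a b : A} :
    (theta Y).r a b ↔ ∀ P ∈ Y, (a ∈ P.carrier ↔ b ∈ P.carrier) := by
  change PrimeFilter.beta a ∩ Y = PrimeFilter.beta b ∩ Y ↔ _
  rw [Set.ext_iff]
  refine forall_congr' fun P => ?_
  change (a ∈ P.carrier ∧ P ∈ Y ↔ b ∈ P.carrier ∧ P ∈ Y) ↔ _
  tauto

/-- A point P of Y outside Z has a neighbourhood β(a) \ β(b) missing Z; then (a, a ⊓ b) is in θ(Z),
but P keeps it out of θ(Y). -/
theorem theta_le_theta_iff {Y Z : Closeds (PrimeFilter A)} :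
    theta (Z : Set (PrimeFilter A)) ≤ theta (Y : Set (PrimeFilter A)) ↔ Y ≤ Z := by
  refine ⟨fun h P hP => ?_, fun h => LatticeCon.le_iff.2 fun a b hab =>
    theta_r_iff.2 fun P hP => theta_r_iff.1 hab P (h hP)⟩
  by_contra hPZ
  obtain ⟨a, b, hab, hsub⟩ := PrimeFilter.exists_beta_diff_subset Z.isClosed.isOpen_compl hPZ
  have hZ : (theta (Z : Set (PrimeFilter A))).r a (a ⊓ b) := theta_r_iff.2 fun Q hQ => by
    rw [Q.inf_mem_iff]
    refine ⟨fun ha => ⟨ha, ?_⟩, And.left⟩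
    by_contra hb
    exact hsub ⟨ha, hb⟩ hQ
  exact hab.2 (P.inf_mem_iff.1 ((theta_r_iff.1 (LatticeCon.le_iff.1 h hZ) P hP).1 hab.1)).2

/-- The closed set of the prime filters that are saturated for a congruence. -/
def LatticeCon.saturatedPrimes (t : LatticeCon A) : Closeds (PrimeFilter A) where
  carrier := {P | ∀ a b, t.r a b → a ∈ P.carrier → b ∈ P.carrier}
  isClosed' := by
    simp only [Set.ofPred_forall]
    refine isClosed_iInter fun a => isClosed_iInter fun b => isClosed_iInter fun _ => ?_
    have h : {P : PrimeFilter A | a ∈ P.carrier → b ∈ P.carrier} =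
        (PrimeFilter.beta a)ᶜ ∪ PrimeFilter.beta b := by
      ext P
      exact imp_iff_not_or
    rw [h]
    exact (PrimeFilter.isOpen_beta a).isClosed_compl.union (PrimeFilter.isClosed_beta b)

/-- The elements below c modulo t form an ideal without a; a prime filter containing a and maximal
among those avoiding it is saturated. -/
theorem LatticeCon.exists_saturated_of_not_r (t : LatticeCon A) {a c : A} (h : ¬ t.r a (a ⊓ c)) :
    ∃ P ∈ t.saturatedPrimes, a ∈ P.carrier ∧ c ∉ P.carrier := by
  have hI : Order.IsIdeal {x | t.r x (x ⊓ c)} := by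
    refine PrimeFilter.isIdeal_of ?_ (fun {x y} hxy hy => ?_) fun {x y} hx hy => ?_
    · rw [Set.mem_ofPred_eq, bot_inf_eq]
    · have := t.inf (t.refl x) hy
      rwa [← inf_assoc, inf_eq_left.2 hxy] at this
    · have := t.sup hx hy
      rwa [← inf_sup_right] at this
  obtain ⟨P, haP, hPI⟩ := PrimeFilter.exists_of_disjoint (PrimeFilter.isPFilter_Ici a) hI
    (PrimeFilter.disjoint_Ici hI h)
  obtain ⟨Q, hPQ, hQ⟩ := P.exists_maximal_disjoint hPI
  refine ⟨Q, fun x y hxy hx => ?_, hPQ (haP le_rfl), fun hc => ?_⟩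
  · by_contra hy
    obtain ⟨p, hp, hpy⟩ := PrimeFilter.exists_inf_mem_of_maximal hI hQ hy
    refine Set.disjoint_left.1 hQ.1 (Q.inf_mem_iff.2 ⟨hp, hx⟩) ?_
    -- p ⊓ x ~ p ⊓ y ~ (p ⊓ y) ⊓ c ~ (p ⊓ x) ⊓ c, which puts p ⊓ x in the ideal.
    have hpxy : t.r (p ⊓ x) (p ⊓ y) := t.inf (t.refl p) hxy
    exact t.trans hpxy (t.trans hpy (t.inf (t.symm hpxy) (t.refl c)))
  · refine Set.disjoint_left.1 hQ.1 hc ?_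
    rw [Set.mem_ofPred_eq, inf_idem]

theorem LatticeCon.theta_saturatedPrimes (t : LatticeCon A) :
    theta (t.saturatedPrimes : Set (PrimeFilter A)) = t := by
  refine le_antisymm (LatticeCon.le_iff.2 fun a b hab => ?_)
    (LatticeCon.le_iff.2 fun a b hab => theta_r_iff.2 fun P hP =>
      ⟨hP a b hab, hP b a (t.symm hab)⟩)
  rw [theta_r_iff] at hab
  have h₁ : t.r a (a ⊓ b) := by
    by_contra hn
    obtain ⟨P, hP, ha, hb⟩ := t.exists_saturated_of_not_r hn
    exact hb ((hab P hP).1 ha)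
  have h₂ : t.r b (b ⊓ a) := by
    by_contra hn
    obtain ⟨P, hP, hb, ha⟩ := t.exists_saturated_of_not_r hn
    exact ha ((hab P hP).2 hb)
  rw [inf_comm] at h₂
  exact t.trans h₁ (t.symm h₂)

theorem mem_of_theta_saturated {Z : Closeds (PrimeFilter A)} {P : PrimeFilter A}
    (h : ∀ a b, (theta (Z : Set (PrimeFilter A))).r a b → a ∈ P.carrier → b ∈ P.carrier) :
    P ∈ Z :=
  (theta_le_theta_iff (Y := (theta (Z : Set (PrimeFilter A))).saturatedPrimes)).1
    (LatticeCon.theta_saturatedPrimes _).ge h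

/-- If `p` on pairs of closed sets corresponds to `q` on pairs of congruences, then `θ` is an
anti-isomorphism between the pairs with `p` and those with `q`. -/
theorem exists_orderIso_theta {B : Type v} [DistribLattice B] [BoundedOrder B]
    {p : Closeds (PrimeFilter A) × Closeds (PrimeFilter B) → Prop}
    {q : LatticeCon A × LatticeCon B → Prop}
    (h : ∀ Z, p Z ↔ q (theta (Z.1 : Set (PrimeFilter A)), theta (Z.2 : Set (PrimeFilter B)))) :
    ∃ e : {Z // p Z} ≃o {t // q t}ᵒᵈ,
      ∀ Z, (OrderDual.ofDual (e Z)).1 = (theta (Z.1.1 : Set _), theta (Z.1.2 : Set _)) := by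
  let F : {Z // p Z} ↪o {t // q t}ᵒᵈ := OrderEmbedding.ofMapLEIff
    (fun Z => OrderDual.toDual
      ⟨(theta (Z.1.1 : Set (PrimeFilter A)), theta (Z.1.2 : Set (PrimeFilter B))), (h Z.1).1 Z.2⟩)
    fun Z W => and_congr theta_le_theta_iff theta_le_theta_iff
  have hF : Function.Surjective F := fun t => by
    obtain ⟨⟨t₁, t₂⟩, ht⟩ := t
    refine ⟨⟨(t₁.saturatedPrimes, t₂.saturatedPrimes), (h _).2 ?_⟩, Subtype.ext (Prod.ext ?_ ?_)⟩
    · simpa only [LatticeCon.theta_saturatedPrimes] using ht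
    · exact t₁.theta_saturatedPrimes
    · exact t₂.theta_saturatedPrimes
  exact ⟨RelIso.ofSurjective F hF, fun _ => rfl⟩

end Congruence

/-! ### Closed pairs and congruences of a FIDL-module -/

namespace FIDLModule

open PrimeFilter

variable {A : Type u} {B : Type v} [DistribLattice A] [BoundedOrder A]
  [DistribLattice B] [BoundedOrder B] (M : FIDLModule A B)

theorem f_mono {a c : A} {b d : B} (hac : a ≤ c) (hbd : b ≤ d) : M.f a b ≤ M.f c d := by
  rw [← sup_eq_right.2 hac, ← sup_eq_right.2 hbd, M.f_sup_left, M.f_sup_right a]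
  exact le_sup_left.trans le_sup_left

theorem i_mono {b d : B} {a c : A} (hbd : d ≤ b) (hac : a ≤ c) : M.i b a ≤ M.i d c := by
  rw [← inf_eq_left.2 hac, ← sup_eq_left.2 hbd, M.i_inf, M.i_sup _ _ c]
  exact inf_le_right.trans inf_le_right

theorem dualSpace_R_iff {Q P : PrimeFilter A} {S : PrimeFilter B} :
    M.dualSpace.R Q S P ↔ ∀ q ∈ Q.carrier, ∀ s ∈ S.carrier, M.f q s ∈ P.carrier :=
  ⟨fun h q hq s hs => h ⟨q, hq, s, hs, le_rfl⟩, fun h _ ⟨q, hq, s, hs, hx⟩ =>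
    P.mem_of_le hx (h q hq s hs)⟩

theorem dualSpace_T_iff {P Q : PrimeFilter A} {S : PrimeFilter B} :
    M.dualSpace.T S P Q ↔ ∀ s ∈ S.carrier, ∀ x, M.i s x ∈ P.carrier → x ∈ Q.carrier :=
  ⟨fun h s hs x hx => h ⟨s, hs, _, hx, le_rfl⟩, fun h _ ⟨s, hs, _, hp, hx⟩ =>
    h s hs _ (P.mem_of_le hx hp)⟩

/-- The elements of `A` that a fusion with an element of `H` sends outside of `P`. -/
def fIdealLeft (H : Set B) (P : PrimeFilter A) : Set A := {x | ∃ s ∈ H, M.f x s ∉ P.carrier}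

/-- The elements of `B` that a fusion with an element of `G` sends outside of `P`. -/
def fIdealRight (G : Set A) (P : PrimeFilter A) : Set B := {s | ∃ x ∈ G, M.f x s ∉ P.carrier}

/-- The elements `s` of `B` with `i(s, x) ∈ P` for some `x ∉ Q`. -/
def iIdeal (P Q : PrimeFilter A) : Set B := {s | ∃ x ∉ Q.carrier, M.i s x ∈ P.carrier}

/-- The elements `x` of `A` with `i(s, x) ∈ P` for some `s ∈ H`. -/
def iFilter (H : Set B) (P : PrimeFilter A) : Set A := {x | ∃ s ∈ H, M.i s x ∈ P.carrier}

/-- For joins, the meet of the two witnesses serves both elements, and primeness of P splits the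
fusion of the join. -/
theorem isIdeal_fIdealLeft {H : Set B} (hH : Order.IsPFilter H) (P : PrimeFilter A) :
    Order.IsIdeal (M.fIdealLeft H P) := by
  refine isIdeal_of ⟨⊤, hH.toPFilter.top_mem, ?_⟩ ?_ ?_
  · rw [M.f_bot_left]
    exact P.bot_notMem
  · rintro a b hab ⟨s, hs, hb⟩
    exact ⟨s, hs, fun h => hb (P.mem_of_le (M.f_mono hab le_rfl) h)⟩
  · rintro a b ⟨s, hs, ha⟩ ⟨s', hs', hb⟩
    refine ⟨s ⊓ s', hH.toPFilter.inf_mem hs hs', fun h => ?_⟩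
    rw [M.f_sup_left] at h
    exact (P.sup_mem_iff.1 h).elim (fun h => ha (P.mem_of_le (M.f_mono le_rfl inf_le_left) h))
      fun h => hb (P.mem_of_le (M.f_mono le_rfl inf_le_right) h)

theorem isIdeal_fIdealRight {G : Set A} (hG : Order.IsPFilter G) (P : PrimeFilter A) :
    Order.IsIdeal (M.fIdealRight G P) := by
  refine isIdeal_of ⟨⊤, hG.toPFilter.top_mem, ?_⟩ ?_ ?_
  · rw [M.f_bot_right]
    exact P.bot_notMem
  · rintro a b hab ⟨x, hx, hb⟩
    exact ⟨x, hx, fun h => hb (P.mem_of_le (M.f_mono le_rfl hab) h)⟩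
  · rintro a b ⟨x, hx, ha⟩ ⟨y, hy, hb⟩
    refine ⟨x ⊓ y, hG.toPFilter.inf_mem hx hy, fun h => ?_⟩
    rw [M.f_sup_right] at h
    exact (P.sup_mem_iff.1 h).elim (fun h => ha (P.mem_of_le (M.f_mono inf_le_left le_rfl) h))
      fun h => hb (P.mem_of_le (M.f_mono inf_le_right le_rfl) h)

/-- The hypothesis i(⊥, x) = ⊤ enters the proof only here, to put ⊥ in the ideal. -/
theorem isIdeal_iIdeal (hM : ∀ x, M.i ⊥ x = ⊤) (P Q : PrimeFilter A) :
    Order.IsIdeal (M.iIdeal P Q) := by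
  refine isIdeal_of ⟨⊥, Q.bot_notMem, ?_⟩ ?_ ?_
  · rw [hM]
    exact P.top_mem
  · rintro a b hab ⟨x, hx, hb⟩
    exact ⟨x, hx, P.mem_of_le (M.i_mono hab le_rfl) hb⟩
  · rintro a b ⟨x, hx, ha⟩ ⟨y, hy, hb⟩
    refine ⟨x ⊔ y, fun h => (Q.sup_mem_iff.1 h).elim hx hy, ?_⟩
    rw [M.i_sup]
    exact P.inf_mem_iff.2 ⟨P.mem_of_le (M.i_mono le_rfl le_sup_left) ha,
      P.mem_of_le (M.i_mono le_rfl le_sup_right) hb⟩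

theorem isPFilter_iFilter {H : Set B} (hH : Order.IsPFilter H) (P : PrimeFilter A) :
    Order.IsPFilter (M.iFilter H P) := by
  refine isPFilter_of ⟨⊤, hH.toPFilter.top_mem, ?_⟩ ?_ ?_
  · rw [M.i_top]
    exact P.top_mem
  · rintro a b hab ⟨s, hs, ha⟩
    exact ⟨s, hs, P.mem_of_le (M.i_mono le_rfl hab) ha⟩
  · rintro a b ⟨s, hs, ha⟩ ⟨s', hs', hb⟩
    refine ⟨s ⊓ s', hH.toPFilter.inf_mem hs hs', ?_⟩
    rw [M.i_inf]
    exact P.inf_mem_iff.2 ⟨P.mem_of_le (M.i_mono inf_le_left le_rfl) ha,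
      P.mem_of_le (M.i_mono inf_le_right le_rfl) hb⟩

theorem dualSpace_R_iff_left {Q P : PrimeFilter A} {S : PrimeFilter B} :
    M.dualSpace.R Q S P ↔ Disjoint Q.carrier (M.fIdealLeft S.carrier P) := by
  rw [dualSpace_R_iff, Set.disjoint_left]
  simp only [fIdealLeft, Set.mem_ofPred_eq, not_exists, not_and, not_not]

theorem dualSpace_R_iff_right {Q P : PrimeFilter A} {S : PrimeFilter B} :
    M.dualSpace.R Q S P ↔ Disjoint S.carrier (M.fIdealRight Q.carrier P) := by
  rw [dualSpace_R_iff, Set.disjoint_left]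
  simp only [fIdealRight, Set.mem_ofPred_eq, not_exists, not_and, not_not]
  exact ⟨fun h _ hs q hq => h q hq _ hs, fun h q hq _ hs => h hs q hq⟩

theorem dualSpace_T_iff_left {P Q : PrimeFilter A} {S : PrimeFilter B} :
    M.dualSpace.T S P Q ↔ Disjoint S.carrier (M.iIdeal P Q) := by
  rw [dualSpace_T_iff, Set.disjoint_left]
  simp only [iIdeal, Set.mem_ofPred_eq, not_exists, not_and]
  exact ⟨fun h s hs x hx hi => hx (h s hs x hi), fun h _ hs x hi => by
    by_contra hx
    exact h hs x hx hi⟩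

theorem dualSpace_T_iff_right {P Q : PrimeFilter A} {S : PrimeFilter B} :
    M.dualSpace.T S P Q ↔ M.iFilter S.carrier P ⊆ Q.carrier := by
  rw [dualSpace_T_iff]
  exact ⟨fun h _ ⟨s, hs, hx⟩ => h s hs _ hx, fun h s hs x hx => h ⟨s, hs, hx⟩⟩

/-- The principal filter of b stands in for S until a first Q₀ is found; then S is maximized against
Q₀, and Q₀ is enlarged to Q against S. -/
theorem exists_mem_maxR {a : A} {b : B} {P : PrimeFilter A} (h : M.f a b ∈ P.carrier) :
    ∃ Q S, (Q, S) ∈ M.dualSpace.maxR P ∧ a ∈ Q.carrier ∧ b ∈ S.carrier := by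
  have hI := M.isIdeal_fIdealLeft (isPFilter_Ici b) P
  obtain ⟨Q₀, haQ₀, hQ₀⟩ := exists_of_disjoint (isPFilter_Ici a) hI <| disjoint_Ici hI <| by
    rintro ⟨s, hs, hn⟩
    exact hn (P.mem_of_le (M.f_mono le_rfl hs) h)
  have hJ := M.isIdeal_fIdealRight Q₀.isPFilter_carrier P
  obtain ⟨S₀, hbS₀, hS₀⟩ := exists_of_disjoint (isPFilter_Ici b) hJ <| disjoint_Ici hJ <| by
    rintro ⟨q, hq, hn⟩
    exact Set.disjoint_left.1 hQ₀ hq ⟨b, le_rfl, hn⟩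
  obtain ⟨S, hS₀S, hS⟩ := S₀.exists_maximal_disjoint hS₀
  obtain ⟨Q, hQ₀Q, hQ⟩ := Q₀.exists_maximal_disjoint
    (M.dualSpace_R_iff_left.1 (M.dualSpace_R_iff_right.2 hS.1))
  refine ⟨Q, S, ⟨?_, ?_, fun S' hS' hle => hS.2 ?_ hle⟩, hQ₀Q (haQ₀ le_rfl), hS₀S (hbS₀ le_rfl)⟩
  · change Maximal (fun Q' => M.dualSpace.R Q' S P) Q
    simpa only [dualSpace_R_iff_left] using hQ
  · exact M.dualSpace_R_iff_left.2 hQ.1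
  -- R is antitone in its first argument: S' related to Q ⊇ Q₀ is also related to Q₀, for which S is
  -- maximal.
  · have hR := M.dualSpace_R_iff.1 hS'
    exact M.dualSpace_R_iff_right.1
      (M.dualSpace_R_iff.2 fun q hq s hs => hR q (hQ₀Q hq) s hs)

/-- Here Q₀ is shrunk to a minimal Q after S is maximized; T is monotone in its last argument, so S
stays maximal for Q. -/
theorem exists_mem_D (hM : ∀ x, M.i ⊥ x = ⊤) {c : A} {d : B} {P : PrimeFilter A}
    (h : M.i d c ∉ P.carrier) :
    ∃ S Q, (S, Q) ∈ M.dualSpace.D P ∧ d ∈ S.carrier ∧ c ∉ Q.carrier := by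
  obtain ⟨Q₀, hFQ₀, hQ₀⟩ := exists_of_disjoint (M.isPFilter_iFilter (isPFilter_Ici d) P)
    (isIdeal_Iic c) <| Set.disjoint_left.2 <| by
      rintro x ⟨s, hs, hx⟩ hxc
      exact h (P.mem_of_le (M.i_mono hs hxc) hx)
  have hJ := M.isIdeal_iIdeal hM P Q₀
  obtain ⟨S₀, hdS₀, hS₀⟩ := exists_of_disjoint (isPFilter_Ici d) hJ <| disjoint_Ici hJ <| by
    rintro ⟨x, hx, hi⟩
    exact hx (hFQ₀ ⟨d, le_rfl, hi⟩)
  obtain ⟨S, hS₀S, hS⟩ := S₀.exists_maximal_disjoint hS₀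
  obtain ⟨Q, hQQ₀, hQ⟩ := Q₀.exists_minimal_superset
    (M.dualSpace_T_iff_right.1 (M.dualSpace_T_iff_left.2 hS.1))
  refine ⟨S, Q, ⟨⟨?_, fun S' hS' hle => hS.2 ?_ hle⟩, ?_⟩, hS₀S (hdS₀ le_rfl),
    fun hc => Set.disjoint_left.1 hQ₀ (hQQ₀ hc) le_rfl⟩
  · exact M.dualSpace_T_iff_right.2 hQ.1
  · exact M.dualSpace_T_iff_left.1
      (M.dualSpace_T_iff_right.2 ((M.dualSpace_T_iff_right.1 hS').trans hQQ₀))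
  · change Minimal (fun Q' => M.dualSpace.T S P Q') Q
    simpa only [dualSpace_T_iff_right] using hQ

theorem isRClosed_iff (Z : Closeds (PrimeFilter A) × Closeds (PrimeFilter B)) :
    M.dualSpace.IsRClosed Z ↔
      M.IsFDLCon (theta (Z.1 : Set (PrimeFilter A)), theta (Z.2 : Set (PrimeFilter B))) := by
  constructor
  · intro hZ
    have key : ∀ ⦃a c : A⦄ ⦃b d : B⦄, (theta (Z.1 : Set (PrimeFilter A))).r a c →
        (theta (Z.2 : Set (PrimeFilter B))).r b d → ∀ P ∈ Z.1, M.f a b ∈ P.carrier →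
        M.f c d ∈ P.carrier := by
      intro a c b d hac hbd P hP hab
      obtain ⟨Q, S, hQS, ha, hb⟩ := M.exists_mem_maxR hab
      obtain ⟨hQ, hS⟩ := hZ P hP hQS
      exact M.dualSpace_R_iff.1 hQS.1.1 c ((theta_r_iff.1 hac Q hQ).1 ha) d
        ((theta_r_iff.1 hbd S hS).1 hb)
    exact fun a c b d hac hbd => theta_r_iff.2 fun P hP =>
      ⟨key hac hbd P hP, key ((theta _).symm hac) ((theta _).symm hbd) P hP⟩
  · rintro h P hP ⟨Q, S⟩ ⟨hQ, hS⟩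
    simp only [BiRel.R1, dualSpace_R_iff_left] at hQ
    simp only [BiRel.R2, dualSpace_R_iff_right] at hS
    refine ⟨mem_of_theta_saturated fun a c hac ha => ?_,
      mem_of_theta_saturated fun b d hbd hb => ?_⟩
    · by_contra hc
      -- f(q ⊓ c, s) ∉ P although the congruent f(q ⊓ a, s) is in P.
      obtain ⟨q, hq, s, hs, hn⟩ :=
        exists_inf_mem_of_maximal (M.isIdeal_fIdealLeft S.isPFilter_carrier P) hQ hc
      have := h ((theta _).inf ((theta _).refl q) hac) ((theta _).refl s)
      exact hn ((theta_r_iff.1 this P hP).1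
        (M.dualSpace_R_iff.1 (M.dualSpace_R_iff_left.2 hQ.1) _ (Q.inf_mem_iff.2 ⟨hq, ha⟩) s hs))
    · by_contra hd
      obtain ⟨s, hs, q, hq, hn⟩ :=
        exists_inf_mem_of_maximal (M.isIdeal_fIdealRight Q.isPFilter_carrier P) hS hd
      have := h ((theta _).refl q) ((theta _).inf ((theta _).refl s) hbd)
      exact hn ((theta_r_iff.1 this P hP).1
        (M.dualSpace_R_iff.1 (M.dualSpace_R_iff_right.2 hS.1) q hq _ (S.inf_mem_iff.2 ⟨hs, hb⟩)))

theorem isTClosed_iff (hM : ∀ x, M.i ⊥ x = ⊤)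
    (Z : Closeds (PrimeFilter A) × Closeds (PrimeFilter B)) :
    M.dualSpace.IsTClosed Z ↔
      M.IsIDLCon (theta (Z.1 : Set (PrimeFilter A)), theta (Z.2 : Set (PrimeFilter B))) := by
  constructor
  · intro hZ
    have key : ∀ ⦃a c : A⦄ ⦃b d : B⦄, (theta (Z.1 : Set (PrimeFilter A))).r a c →
        (theta (Z.2 : Set (PrimeFilter B))).r b d → ∀ P ∈ Z.1, M.i b a ∈ P.carrier →
        M.i d c ∈ P.carrier := by
      intro a c b d hac hbd P hP hab
      by_contra hn
      obtain ⟨S, Q, hSQ, hd, hc⟩ := M.exists_mem_D hM hn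
      obtain ⟨hS, hQ⟩ := hZ P hP hSQ
      exact hc ((theta_r_iff.1 hac Q hQ).1
        (M.dualSpace_T_iff.1 hSQ.1.1 b ((theta_r_iff.1 hbd S hS).2 hd) a hab))
    exact fun a c b d hac hbd => theta_r_iff.2 fun P hP =>
      ⟨key hac hbd P hP, key ((theta _).symm hac) ((theta _).symm hbd) P hP⟩
  · rintro h P hP ⟨S, Q⟩ ⟨hS, hQ⟩
    simp only [BiRel.T1, dualSpace_T_iff_left] at hS
    simp only [BiRel.T3, dualSpace_T_iff_right] at hQ
    have hT := M.dualSpace_T_iff.1 (M.dualSpace_T_iff_right.2 hQ.1)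
    refine ⟨mem_of_theta_saturated fun b d hbd hb => ?_,
      mem_of_theta_saturated fun a c hac ha => ?_⟩
    · by_contra hd
      -- i(s ⊓ d, x) ∈ P yields i(s ⊓ b, x) ∈ P, and T then forces x ∈ Q.
      obtain ⟨s, hs, x, hx, hi⟩ := exists_inf_mem_of_maximal (M.isIdeal_iIdeal hM P Q) hS hd
      have := h ((theta _).refl x) ((theta _).inf ((theta _).refl s) hbd)
      exact hx (hT _ (S.inf_mem_iff.2 ⟨hs, hb⟩) x ((theta_r_iff.1 this P hP).2 hi))
    · by_contra hc
      -- i(s, y ⊔ a) ∈ P yields i(s, y ⊔ c) ∈ P, so y ⊔ c ∈ Q with neither y nor c in the prime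
      -- filter Q.
      obtain ⟨y, hy, s, hs, hi⟩ :=
        exists_sup_mem_of_minimal (M.isPFilter_iFilter S.isPFilter_carrier P) hQ ha
      have := h ((theta _).sup ((theta _).refl y) hac) ((theta _).refl s)
      exact (Q.sup_mem_iff.1 (hT s hs _ ((theta_r_iff.1 this P hP).1 hi))).elim hy hc

end FIDLModule

theorem mainTheorem5 {A : Type u} {B : Type v} [DistribLattice A] [BoundedOrder A]
    [DistribLattice B] [BoundedOrder B] (M : FIDLModule A B) :
    (∃ e : {Z : Closeds (PrimeFilter A) × Closeds (PrimeFilter B) // M.dualSpace.IsRClosed Z} ≃o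
          {t : LatticeCon A × LatticeCon B // M.IsFDLCon t}ᵒᵈ,
        ∀ Z, (OrderDual.ofDual (e Z)).1 = (theta (Z.1.1 : Set _), theta (Z.1.2 : Set _))) ∧
    ((∀ x : A, M.i ⊥ x = ⊤) →
      (∃ e : {Z : Closeds (PrimeFilter A) × Closeds (PrimeFilter B) //
              M.dualSpace.IsTClosed Z} ≃o
            {t : LatticeCon A × LatticeCon B // M.IsIDLCon t}ᵒᵈ,
          ∀ Z, (OrderDual.ofDual (e Z)).1 = (theta (Z.1.1 : Set _), theta (Z.1.2 : Set _))) ∧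
      (∃ e : {Z : Closeds (PrimeFilter A) × Closeds (PrimeFilter B) //
              M.dualSpace.IsStronglyClosed Z} ≃o
            {t : LatticeCon A × LatticeCon B // M.IsFIDLCon t}ᵒᵈ,
          ∀ Z, (OrderDual.ofDual (e Z)).1 = (theta (Z.1.1 : Set _), theta (Z.1.2 : Set _)))) := by
  refine ⟨exists_orderIso_theta M.isRClosed_iff, fun hM =>
    ⟨exists_orderIso_theta (M.isTClosed_iff hM), exists_orderIso_theta fun Z => ?_⟩⟩
  exact and_congr (M.isRClosed_iff Z) (M.isTClosed_iff hM Z)
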